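/- Let $\mathscr C$ be the class of all finite simple undirected graphs (no loops, no multiple edges) with nonempty vertex set, quasiordered by $G\le H$ if and only if there is a graph homomorphism $G\to H$ (a map of vertex sets that sends edges to edges), and write $G<H$ if $G\le H$ and $H\not\le G$. Two graphs are homomorphism equivalent if $G\le H$ and $H\le G$; identifying homomorphism equivalent graphs turns $(\mathscr C,\le)$ into a partial order, the homomorphism order. Then $(\mathscr C,\le)$ has the fractal property: for every pair of graphs $G_1<G_2$ such that it is not the case that $G_1$ is homomorphism equivalent to $K_1$ and $G_2$ is homomorphism equivalent to $K_2$, there exists an order embedding $\Phi$ of the whole homomorphism order into its open interval $$[G_1,G_2]_{\mathscr C}=\{H : G_1<H<G_2\},$$ that is, a map $\Phi$ (injective on equivalence classes) with $G_1<\Phi(H)<G_2$ for all $H$, and $H\le H'$ if and only if $\Phi(H)\le\Phi(H')$ for all $H,H'$. -/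

import Mathlib

/-- A finite simple undirected graph (no loops, no multiple edges) with a nonempty vertex set.
Every such graph is isomorphic to one whose vertex type lives in `Type`. -/
structure FinGraph where
  /-- the vertex set -/
  V : Type
  /-- the vertex set is finite -/
  finite : Finite V
  /-- the vertex set is nonempty -/
  nonempty : Nonempty V
  /-- the graph structure -/
  graph : SimpleGraph V

namespace FinGraph

/-- The homomorphism quasiorder: `G ≤ H` iff there is a graph homomorphism `G → H`. -/
instance : Preorder FinGraph where
  le G H := Nonempty (G.graph →g H.graph)
  le_refl _ := ⟨SimpleGraph.Hom.id⟩
  le_trans _ _ _ := fun ⟨f⟩ ⟨g⟩ => ⟨g.comp f⟩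

/-- The complete graph on `n ≥ 1` vertices. -/
def complete (n : ℕ) [NeZero n] : FinGraph where
  V := Fin n
  finite := inferInstance
  nonempty := inferInstance
  graph := ⊤

/-- Homomorphism equivalence: homomorphisms exist in both directions. -/
def HomEquiv (G H : FinGraph) : Prop := G ≤ H ∧ H ≤ G

end FinGraph

/-- The homomorphism order: the partial order obtained from the homomorphism quasiorder on
finite graphs by identifying homomorphism equivalent graphs. -/
abbrev HomOrder : Type 1 := Antisymmetrization FinGraph (· ≤ ·)

/-- The homomorphism equivalence class of a finite graph. -/
def FinGraph.toHomOrder (G : FinGraph) : HomOrder := toAntisymmetrization (· ≤ ·) G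

/-!
The homomorphism order is a countable lattice: joins are disjoint unions and meets are categorical
products. Hence it suffices to embed every countable partial order into the open interval.

In a bounded lattice this is possible as soon as there is a sequence `a₀, a₁, …` no finite meet of
which lies below a finite join of other terms (the empty meet is the top, the empty join the
bottom): see `exists_orderEmbedding_of_countable`. Such a sequence is built term by term. At each
stage finitely many relations `u ≰ v` have to survive, in the sense that the new term `a` must
satisfy `u ⊓ a ≰ v` and `u ≰ v ⊔ a`.

For graphs, such an `a` comes from one graph `A` of large odd girth and large chromatic number,
truncated to the interval (`HomOrder.exists_separating`). If `U × A → V`, then either `U → V` or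
`A` is coloured by the maps from the vertices of `U` to those of `V`. If `U → V + A`, then the part
of `U` mapped into `A` is bipartite because `A` has no short odd closed walk, so it can be mapped to
an edge of `V`, whence `U → V`. The latter needs `K₂ ≤ V`, which is arranged by raising the lower
end `G₁` of the interval to `G₁ + K₂`. The graphs `A` are iterated shift graphs.
-/

/-! ### Iterated shift graphs: large odd girth and large chromatic number -/

/-- The iterated shift graph on the strictly increasing `(k + 1)`-tuples in `{0, …, N - 1}`:
`(a₀, …, aₖ)` is adjacent to `(a₁, …, aₖ, b)` for `b > aₖ`. The condition on the zeroth entries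
only matters for `k = 0`, where it makes the graph complete. -/
def shiftGraph (k N : ℕ) : SimpleGraph (Fin (k + 1) ↪o Fin N) where
  Adj t s := (t 0 < s 0 ∧ ∀ j : Fin k, t j.succ = s j.castSucc) ∨
    (s 0 < t 0 ∧ ∀ j : Fin k, s j.succ = t j.castSucc)
  symm := ⟨fun _ _ h => h.symm⟩
  loopless := ⟨fun _ h => by simp at h⟩

/-- Along a walk of length `ℓ` the entries far enough from both ends are only moved, all by the
same amount `d`, the number of forward steps minus the number of backward steps. -/
lemma shiftGraph_walk_shift {k N : ℕ} {t s : Fin (k + 1) ↪o Fin N} (w : (shiftGraph k N).Walk t s) :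
    ∃ d : ℤ, |d| ≤ w.length ∧ Even (d + w.length) ∧ ∀ i j : Fin (k + 1),
      w.length ≤ (i : ℕ) → (i : ℕ) + w.length ≤ k → (j : ℤ) = i + d → s i = t j := by
  induction w with
  | nil =>
    refine ⟨0, by simp, by simp, fun i j _ _ h => ?_⟩
    congr 1
    ext
    omega
  | @cons t t' s h p ih =>
    obtain ⟨d, hd, he, hs⟩ := ih
    rw [abs_le] at hd
    simp only [SimpleGraph.Walk.length_cons]
    rcases h with ⟨-, h⟩ | ⟨-, h⟩
    · refine ⟨d + 1, by rw [abs_le]; push_cast; omega, ?_, fun i j hi hi' hj => ?_⟩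
      · push_cast
        have : d + 1 + (p.length + 1) = d + p.length + 2 := by ring
        rw [this]
        exact he.add even_two
      · obtain ⟨j', hj'⟩ : ∃ j' : ℕ, (j' : ℤ) = i + d := ⟨(i + d : ℤ).toNat, by omega⟩
        have hk : j' < k := by omega
        rw [hs i (Fin.castSucc ⟨j', hk⟩) (by omega) (by omega) (by simpa using hj'), ← h]
        congr 1
        ext
        simp only [Fin.val_succ]
        omega
    · refine ⟨d - 1, by rw [abs_le]; push_cast; omega, ?_, fun i j hi hi' hj => ?_⟩
      · push_cast
        have : d - 1 + (p.length + 1) = d + p.length := by ring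
        rwa [this]
      · have hk : (j : ℕ) < k := by omega
        rw [hs i (Fin.succ ⟨j, hk⟩) (by omega) (by omega) (by simp; omega), h]
        rfl

lemma shiftGraph_even_length {k N : ℕ} {t : Fin (k + 1) ↪o Fin N}
    (w : (shiftGraph k N).Walk t t) (hw : 2 * w.length ≤ k) : Even w.length := by
  obtain ⟨d, hd, he, hs⟩ := shiftGraph_walk_shift w
  rw [abs_le] at hd
  obtain ⟨j, hj⟩ : ∃ j : ℕ, (j : ℤ) = w.length + d := ⟨(w.length + d : ℤ).toNat, by omega⟩
  have h := t.injective (hs ⟨w.length, by omega⟩ ⟨j, by omega⟩ le_rfl (by simp; omega)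
    (by simpa using hj))
  rw [Fin.mk.injEq] at h
  obtain rfl : d = 0 := by omega
  simpa using he

/-- Passing from `k` to `k + 1` costs one exponential: a colouring of the `(k + 2)`-tuples colours
each `(k + 1)`-tuple by the set of colours of its one-step extensions. -/
lemma exists_isEmpty_shiftGraph_coloring (k : ℕ) (α : Type) [Finite α] :
    ∃ N, IsEmpty ((shiftGraph k N).Coloring α) := by
  induction k generalizing α with
  | zero =>
    refine ⟨Nat.card α + 1, ⟨fun C => ?_⟩⟩
    let e : Fin (Nat.card α + 1) → (Fin (0 + 1) ↪o Fin (Nat.card α + 1)) := fun a =>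
      OrderEmbedding.ofStrictMono (fun _ => a) (Subsingleton.strictMono (α := Fin 1) _)
    have hinj : Function.Injective fun a => C (e a) := by
      intro a b hab
      by_contra hne
      refine C.valid (v := e a) (w := e b) ?_ hab
      rcases lt_or_gt_of_ne hne with h | h
      · exact Or.inl ⟨h, fun j => j.elim0⟩
      · exact Or.inr ⟨h, fun j => j.elim0⟩
    have := Nat.card_le_card_of_injective _ hinj
    simp at this
  | succ k ih =>
    obtain ⟨N, ⟨hN⟩⟩ := ih (Set α)
    refine ⟨N, ⟨fun C => ?_⟩⟩
    let D : (Fin (k + 1) ↪o Fin N) → Set α := fun t =>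
      {c | ∃ r : Fin (k + 1 + 1) ↪o Fin N, (∀ i : Fin (k + 1), r i.castSucc = t i) ∧ C r = c}
    have key : ∀ t s : Fin (k + 1) ↪o Fin N, t 0 < s 0 →
        (∀ j : Fin k, t j.succ = s j.castSucc) → D t ≠ D s := by
      intro t s h0 hts heq
      -- the extension of `t` by the last entry of `s`
      let r : Fin (k + 1 + 1) ↪o Fin N :=
        OrderEmbedding.ofStrictMono (Fin.cons (t 0) s : Fin (k + 1 + 1) → Fin N) (by
          rw [Fin.strictMono_iff_lt_succ]
          intro i
          refine Fin.cases ?_ (fun j => ?_) i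
          · simp [h0]
          · rw [← Fin.succ_castSucc]
            simp)
      have hr0 : r 0 = t 0 := rfl
      have hrs : ∀ i : Fin (k + 1), r i.succ = s i := fun i => rfl
      have hrt : ∀ i : Fin (k + 1), r i.castSucc = t i := by
        intro i
        refine Fin.cases ?_ (fun j => ?_) i
        · exact hr0
        · rw [← Fin.succ_castSucc, hrs, hts]
      have hmem := (Set.ext_iff.1 heq (C r)).1 ⟨r, hrt, rfl⟩
      obtain ⟨r', hr', hC⟩ := hmem
      refine C.valid (v := r) (w := r') (Or.inl ⟨?_, fun j => ?_⟩) hC.symm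
      · exact (hr' 0).symm ▸ h0
      · rw [hrs, hr']
    refine hN (SimpleGraph.Coloring.mk D fun {t s} h => ?_)
    rcases h with ⟨h0, h⟩ | ⟨h0, h⟩
    · exact key t s h0 h
    · exact (key s t h0 h).symm

lemma FinGraph.exists_large_oddGirth_not_colorable (ℓ c : ℕ) :
    ∃ A : FinGraph, (∀ a (w : A.graph.Walk a a), w.length ≤ ℓ → Even w.length) ∧
      ¬ A.graph.Colorable c := by
  obtain ⟨N, ⟨hN⟩⟩ := exists_isEmpty_shiftGraph_coloring (2 * ℓ) (Fin c)
  have hne : Nonempty (Fin (2 * ℓ + 1) ↪o Fin N) := by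
    by_contra h
    rw [not_nonempty_iff] at h
    exact hN (SimpleGraph.Coloring.mk (fun t => h.elim t) fun {t} _ => h.elim t)
  exact ⟨⟨_, Finite.of_injective _ DFunLike.coe_injective, hne, shiftGraph (2 * ℓ) N⟩,
    fun a w hw => shiftGraph_even_length w (by omega), fun ⟨C⟩ => hN C⟩

/-! ### The lattice structure of the homomorphism order -/

namespace FinGraph

/-- The disjoint union of two finite graphs, their join in the homomorphism order. -/
def sum (G H : FinGraph) : FinGraph where
  V := G.V ⊕ H.V
  finite := have := G.finite; have := H.finite; inferInstance
  nonempty := have := G.nonempty; inferInstance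
  graph := G.graph.sum H.graph

/-- The categorical (tensor) product of two finite graphs, in which two pairs are adjacent when
they are adjacent in both coordinates; it is their meet in the homomorphism order. -/
def prod (G H : FinGraph) : FinGraph where
  V := G.V × H.V
  finite := have := G.finite; have := H.finite; inferInstance
  nonempty := have := G.nonempty; have := H.nonempty; inferInstance
  graph :=
    { Adj := fun p q => G.graph.Adj p.1 q.1 ∧ H.graph.Adj p.2 q.2
      symm := ⟨fun _ _ h => ⟨h.1.symm, h.2.symm⟩⟩
      loopless := ⟨fun _ h => G.graph.loopless.irrefl _ h.1⟩ }

lemma le_sum_left (G H : FinGraph) : G ≤ G.sum H := ⟨SimpleGraph.Embedding.sumInl.toHom⟩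

lemma le_sum_right (G H : FinGraph) : H ≤ G.sum H := ⟨SimpleGraph.Embedding.sumInr.toHom⟩

lemma sum_le {G H K : FinGraph} : G ≤ K → H ≤ K → G.sum H ≤ K := by
  rintro ⟨f⟩ ⟨g⟩
  refine ⟨⟨Sum.elim f g, ?_⟩⟩
  rintro (a | a) (b | b) h
  · exact f.map_adj (SimpleGraph.sum_adj_inl.1 h)
  · exact absurd h (SimpleGraph.not_adj_sum_inl_inr a b)
  · exact absurd h.symm (SimpleGraph.not_adj_sum_inl_inr b a)
  · exact g.map_adj (SimpleGraph.sum_adj_inr.1 h)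

lemma prod_le_left (G H : FinGraph) : G.prod H ≤ G := ⟨⟨Prod.fst, fun h => h.1⟩⟩

lemma prod_le_right (G H : FinGraph) : G.prod H ≤ H := ⟨⟨Prod.snd, fun h => h.2⟩⟩

lemma le_prod {G H K : FinGraph} : K ≤ G → K ≤ H → K ≤ G.prod H := fun ⟨f⟩ ⟨g⟩ =>
  ⟨⟨fun x => (f x, g x), fun h => ⟨f.map_adj h, g.map_adj h⟩⟩⟩

end FinGraph

instance HomOrder.instLattice : Lattice HomOrder where
  sup := Quotient.map₂ FinGraph.sum fun _ _ h _ _ h' =>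
    ⟨FinGraph.sum_le (h.1.trans (FinGraph.le_sum_left _ _)) (h'.1.trans (FinGraph.le_sum_right _ _)),
      FinGraph.sum_le (h.2.trans (FinGraph.le_sum_left _ _)) (h'.2.trans (FinGraph.le_sum_right _ _))⟩
  inf := Quotient.map₂ FinGraph.prod fun _ _ h _ _ h' =>
    ⟨FinGraph.le_prod ((FinGraph.prod_le_left _ _).trans h.1) ((FinGraph.prod_le_right _ _).trans h'.1),
      FinGraph.le_prod ((FinGraph.prod_le_left _ _).trans h.2) ((FinGraph.prod_le_right _ _).trans h'.2)⟩
  le_sup_left a b := Quotient.inductionOn₂ a b FinGraph.le_sum_left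
  le_sup_right a b := Quotient.inductionOn₂ a b FinGraph.le_sum_right
  sup_le a b c := Quotient.inductionOn₃ a b c fun _ _ _ => FinGraph.sum_le
  inf_le_left a b := Quotient.inductionOn₂ a b FinGraph.prod_le_left
  inf_le_right a b := Quotient.inductionOn₂ a b FinGraph.prod_le_right
  le_inf a b c := Quotient.inductionOn₃ a b c fun _ _ _ => FinGraph.le_prod

/-- Every finite graph is isomorphic to one on the vertex set `Fin n`, and there are countably many
of these. -/
instance HomOrder.instCountable : Countable HomOrder := by
  let f : (Σ n : ℕ, SimpleGraph (Fin (n + 1))) → HomOrder := fun p =>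
    FinGraph.toHomOrder ⟨Fin (p.1 + 1), inferInstance, inferInstance, p.2⟩
  have hf : Function.Surjective f := by
    intro a
    induction a using Quotient.inductionOn with | _ G =>
    have := G.finite
    have := G.nonempty
    obtain ⟨n, ⟨e⟩⟩ := Finite.exists_equiv_fin G.V
    cases n with
    | zero => exact (e (Classical.arbitrary _)).elim0
    | succ n =>
      let i := SimpleGraph.Iso.map e G.graph
      exact ⟨⟨n, _⟩, Quotient.sound ⟨⟨i.symm.toHom⟩, ⟨i.toHom⟩⟩⟩
  exact hf.countable

/-! ### Separating finitely many pairs by one graph -/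

namespace FinGraph

/-- A homomorphism `h : U × A → V` colours `a` by the map `h (·, a)`; were two adjacent vertices
given the same map, it would be a homomorphism `U → V`. -/
lemma colorable_of_prod_le {U V A : FinGraph} (hUV : ¬ U ≤ V) (h : U.prod A ≤ V) :
    A.graph.Colorable (Nat.card (U.V → V.V)) := by
  obtain ⟨f⟩ := h
  have := U.finite
  have := V.finite
  let C : A.graph.Coloring (U.V → V.V) :=
    SimpleGraph.Coloring.mk (fun a x => f (x, a)) fun {a b} hab heq =>
      hUV ⟨⟨fun x => f (x, a), fun {x y} hxy => by
        have hy : f (y, a) = f (y, b) := congrFun heq y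
        rw [hy]
        exact f.map_adj ⟨hxy, hab⟩⟩⟩
  have := Fintype.ofFinite (U.V → V.V)
  rw [Nat.card_eq_fintype_card]
  exact C.colorable

/-- Given a homomorphism `U → V + A`, the part of `U` that lands in `A` is bipartite as soon as the
odd girth of `A` exceeds that of every nonbipartite induced subgraph of `U`. It can then be sent to
an edge of `V` instead. -/
lemma exists_le_of_le_sum (U : FinGraph) : ∃ ℓ : ℕ, ∀ V A : FinGraph, complete 2 ≤ V →
    (∀ a (w : A.graph.Walk a a), w.length ≤ ℓ → Even w.length) → U ≤ V.sum A → U ≤ V := by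
  have hQ : ∀ Q : Set U.V, ∃ ℓ : ℕ, (∀ x (w : (U.graph.induce Q).Walk x x),
      w.length ≤ ℓ → Even w.length) → (U.graph.induce Q).Colorable 2 := by
    intro Q
    by_cases hc : (U.graph.induce Q).Colorable 2
    · exact ⟨0, fun _ => hc⟩
    · have hc' := hc
      rw [SimpleGraph.two_colorable_iff_forall_loop_even] at hc'
      push Not at hc'
      obtain ⟨x, w, hw⟩ := hc'
      exact ⟨w.length, fun h => absurd (h x w le_rfl) (by simpa using hw)⟩
  choose ℓ hℓ using hQ
  have := U.finite
  obtain ⟨m, hm⟩ := (Set.finite_range ℓ).bddAbove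
  refine ⟨m, ?_⟩
  rintro V A ⟨e⟩ hA ⟨f⟩
  let Q : Set U.V := {x | ∃ a, f x = Sum.inr a}
  choose g hg using fun x : Q => x.2
  let g' : U.graph.induce Q →g A.graph := ⟨g, fun {x y} hxy => by
    have h := f.map_adj hxy
    simp only [Function.Embedding.subtype_apply] at h
    rw [hg, hg] at h
    exact SimpleGraph.sum_adj_inr.1 h⟩
  obtain ⟨C⟩ := hℓ Q fun x w hw => by
    have h := hA _ (w.map g') (by simpa using hw.trans (hm ⟨Q, rfl⟩))
    simpa using h
  have hφ : ∀ x, ∃ y : V.V, (∀ h : x ∈ Q, y = e (C ⟨x, h⟩)) ∧ ∀ v, f x = Sum.inl v → y = v := by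
    intro x
    rcases hx : f x with v | a
    · refine ⟨v, ?_, fun v' hv' => Sum.inl.inj hv'⟩
      rintro ⟨a, ha⟩
      simp [hx] at ha
    · exact ⟨e (C ⟨x, a, hx⟩), fun _ => rfl, fun v hv => by simp at hv⟩
  choose φ hφr hφl using hφ
  refine ⟨⟨φ, fun {x y} hxy => ?_⟩⟩
  have h := f.map_adj hxy
  rcases hx : f x with v | a <;> rcases hy : f y with v' | a' <;> rw [hx, hy] at h
  · rw [hφl x v hx, hφl y v' hy]
    exact SimpleGraph.sum_adj_inl.1 h
  · exact absurd h (SimpleGraph.not_adj_sum_inl_inr _ _)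
  · exact absurd h.symm (SimpleGraph.not_adj_sum_inl_inr _ _)
  · rw [hφr x ⟨a, hx⟩, hφr y ⟨a', hy⟩]
    exact e.map_adj (C.map_adj hxy)

end FinGraph

/-- A single graph `A` of large odd girth and large chromatic number works: large chromatic number
takes care of the meets and large odd girth of the joins. -/
lemma HomOrder.exists_separating (F : Finset (HomOrder × HomOrder))
    (hF : ∀ p ∈ F, ¬ p.1 ≤ p.2 ∧ (FinGraph.complete 2).toHomOrder ≤ p.2) :
    ∃ a : HomOrder, ∀ p ∈ F, ¬ p.1 ⊓ a ≤ p.2 ∧ ¬ p.1 ≤ p.2 ⊔ a := by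
  let rep : HomOrder → FinGraph := Quotient.out
  have hrep : ∀ x, (rep x).toHomOrder = x := Quotient.out_eq
  choose ℓ hℓ using FinGraph.exists_le_of_le_sum
  obtain ⟨A, hA, hc⟩ := FinGraph.exists_large_oddGirth_not_colorable
    (F.sup fun p => ℓ (rep p.1)) (F.sup fun p => Nat.card ((rep p.1).V → (rep p.2).V))
  refine ⟨A.toHomOrder, fun p hp => ?_⟩
  obtain ⟨hp1, hp2⟩ := hF p hp
  have h1 := Finset.le_sup (f := fun p => ℓ (rep p.1)) hp
  have h2 := Finset.le_sup (f := fun p => Nat.card ((rep p.1).V → (rep p.2).V)) hp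
  rw [← hrep p.1, ← hrep p.2] at hp1 ⊢
  rw [← hrep p.2] at hp2
  refine ⟨fun h => hc ?_, fun h => hp1 ?_⟩
  · exact (FinGraph.colorable_of_prod_le hp1 h).mono h2
  · exact hℓ (rep p.1) (rep p.2) A hp2 (fun a w hw => hA a w (hw.trans h1)) h

/-! ### Independent sequences and the embedding of countable partial orders -/

section Independent

variable {L : Type*} [Lattice L] [BoundedOrder L] [Nontrivial L]

/-- If finitely many non-inequalities can always be preserved by one more element, then there is an
independent sequence: no meet of finitely many terms lies below a join of finitely many others.
Here `u` plays the role of the meet of the terms indexed by `S` and `v` that of the join of the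
other ones. -/
lemma exists_independent_seq
    (hL : ∀ F : Finset (L × L), (∀ p ∈ F, ¬ p.1 ≤ p.2) →
      ∃ a, ∀ p ∈ F, ¬ p.1 ⊓ a ≤ p.2 ∧ ¬ p.1 ≤ p.2 ⊔ a) :
    ∃ a : ℕ → L, ∀ (S : Set ℕ) (n : ℕ), ∃ u v, ¬ u ≤ v ∧
      ∀ i < n, (i ∈ S → u ≤ a i) ∧ (i ∉ S → a i ≤ v) := by
  classical
  let X := {F : Finset (L × L) // ∀ p ∈ F, ¬ p.1 ≤ p.2}
  choose a ha using fun F : X => hL F.1 F.2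
  let next : X → X := fun F =>
    ⟨F.1.image (fun p => (p.1 ⊓ a F, p.2)) ∪ F.1.image (fun p => (p.1, p.2 ⊔ a F)), by
      intro q hq
      simp only [Finset.mem_union, Finset.mem_image] at hq
      rcases hq with ⟨p, hp, rfl⟩ | ⟨p, hp, rfl⟩
      · exact (ha F p hp).1
      · exact (ha F p hp).2⟩
  let F : ℕ → X := fun n => next^[n] ⟨{(⊤, ⊥)}, by simp⟩
  have hF : ∀ n, F (n + 1) = next (F n) := fun n => Function.iterate_succ_apply' _ _ _
  refine ⟨fun n => a (F n), fun S n => ?_⟩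
  suffices h : ∃ p ∈ (F n).1, ∀ i < n, (i ∈ S → p.1 ≤ a (F i)) ∧ (i ∉ S → a (F i) ≤ p.2) by
    obtain ⟨p, hp, h⟩ := h
    exact ⟨p.1, p.2, (F n).2 p hp, h⟩
  induction n with
  | zero => exact ⟨(⊤, ⊥), by simp [F], by simp⟩
  | succ n ih =>
    obtain ⟨p, hp, h⟩ := ih
    rw [hF]
    by_cases hn : n ∈ S
    · refine ⟨(p.1 ⊓ a (F n), p.2), Finset.mem_union_left _ (Finset.mem_image_of_mem _ hp),
        fun i hi => ?_⟩
      rcases Nat.lt_succ_iff_lt_or_eq.1 hi with hi | rfl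
      · exact ⟨fun hS => inf_le_left.trans ((h i hi).1 hS), (h i hi).2⟩
      · exact ⟨fun _ => inf_le_right, fun hS => absurd hn hS⟩
    · refine ⟨(p.1, p.2 ⊔ a (F n)), Finset.mem_union_right _ (Finset.mem_image_of_mem _ hp),
        fun i hi => ?_⟩
      rcases Nat.lt_succ_iff_lt_or_eq.1 hi with hi | rfl
      · exact ⟨(h i hi).1, fun hS => ((h i hi).2 hS).trans le_sup_left⟩
      · exact ⟨fun hS => absurd hS hn, fun _ => le_sup_right⟩

/-- With an enumeration of `P` and an independent sequence `a` indexed by `P`, the embedding is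
`x ↦ ⨆ y, ⨅ z, a z`, where `y` runs over the elements `≤ x` that do not come after `x`, and `z`
over the elements `≥ y` that do not come after `y`. -/
lemma exists_orderEmbedding_of_countable
    (hL : ∀ F : Finset (L × L), (∀ p ∈ F, ¬ p.1 ≤ p.2) →
      ∃ a, ∀ p ∈ F, ¬ p.1 ⊓ a ≤ p.2 ∧ ¬ p.1 ≤ p.2 ⊔ a)
    (P : Type*) [PartialOrder P] [Countable P] :
    ∃ f : P ↪o L, ∀ x, ⊥ < f x ∧ f x < ⊤ := by
  obtain ⟨a, ha⟩ := exists_independent_seq hL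
  obtain ⟨idx, hidx⟩ := exists_injective_nat P
  have hfin : ∀ n, {x | idx x ≤ n}.Finite := fun n =>
    (Set.finite_Iic n).preimage hidx.injOn
  have hup : ∀ y, {z | y ≤ z ∧ idx z ≤ idx y}.Finite := fun y =>
    (hfin (idx y)).subset fun _ h => h.2
  have hdn : ∀ x, {y | y ≤ x ∧ idx y ≤ idx x}.Finite := fun x =>
    (hfin (idx x)).subset fun _ h => h.2
  let m : P → L := fun y => (hup y).toFinset.inf fun z => a (idx z)
  let f : P → L := fun x => (hdn x).toFinset.sup m
  have hm : ∀ {y z}, y ≤ z → idx z ≤ idx y → m y ≤ a (idx z) := fun h h' =>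
    Finset.inf_le (by simpa using ⟨h, h'⟩)
  have hle_m : ∀ {y u}, (∀ z, y ≤ z → idx z ≤ idx y → u ≤ a (idx z)) → u ≤ m y := fun h =>
    Finset.le_inf fun z hz =>
      h z ((hup _).mem_toFinset.1 hz).1 ((hup _).mem_toFinset.1 hz).2
  have hf : ∀ {x y}, y ≤ x → idx y ≤ idx x → m y ≤ f x := fun h h' =>
    Finset.le_sup (by simpa using ⟨h, h'⟩)
  have hf_le : ∀ {x v}, (∀ y, y ≤ x → idx y ≤ idx x → m y ≤ v) → f x ≤ v := fun h =>
    Finset.sup_le fun z hz =>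
      h z ((hdn _).mem_toFinset.1 hz).1 ((hdn _).mem_toFinset.1 hz).2
  have hmono : ∀ {x x'}, x ≤ x' → f x ≤ f x' := by
    intro x x' hx
    refine hf_le fun y hy hyi => ?_
    rcases le_total (idx y) (idx x') with h | h
    · exact hf (hy.trans hx) h
    · -- `y` comes after `x'`, so every index of `m x'` is an index of `m y`
      exact (hle_m fun z hz hzi => hm ((hy.trans hx).trans hz) (hzi.trans h)).trans (hf le_rfl le_rfl)
  have hrefl : ∀ {x x'}, f x ≤ f x' → x ≤ x' := by
    intro x x' hff
    by_contra hx
    obtain ⟨u, v, huv, h⟩ := ha (idx '' {z | x ≤ z}) (max (idx x) (idx x') + 1)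
    refine huv (((hle_m fun z hz hzi => ?_).trans (hf le_rfl le_rfl)).trans
      (hff.trans (hf_le fun y hy hyi => ?_)))
    · exact (h _ (by omega)).1 ⟨z, hz, rfl⟩
    · refine (hm le_rfl le_rfl).trans ((h _ (by omega)).2 ?_)
      rintro ⟨z, hz, hzy⟩
      exact hx ((hidx hzy ▸ hz : x ≤ y).trans hy)
  refine ⟨OrderEmbedding.ofMapLEIff f fun x x' => ⟨hrefl, hmono⟩, fun x => ⟨?_, ?_⟩⟩
  · rw [bot_lt_iff_ne_bot]
    intro hx
    obtain ⟨u, v, huv, h⟩ := ha Set.univ (idx x + 1)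
    have hu : u ≤ f x :=
      (hle_m fun z _ hzi => (h _ (by omega)).1 trivial).trans (hf le_rfl le_rfl)
    exact huv ((hu.trans hx.le).trans bot_le)
  · rw [lt_top_iff_ne_top]
    intro hx
    obtain ⟨u, v, huv, h⟩ := ha ∅ (idx x + 1)
    have hv : f x ≤ v := hf_le fun y _ hyi =>
      (hm le_rfl le_rfl).trans ((h _ (by omega)).2 (Set.notMem_empty _))
    exact huv (le_top.trans (hx.ge.trans hv))

end Independent

/-! ### Intervals above an edge -/

lemma HomOrder.exists_orderEmbedding_Icc {b t : HomOrder} [Fact (b ≤ t)] (hbt : ¬ t ≤ b)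
    (hb : (FinGraph.complete 2).toHomOrder ≤ b) :
    ∃ f : HomOrder ↪o Set.Icc b t, ∀ x, ⊥ < f x ∧ f x < ⊤ := by
  classical
  have : Nontrivial (Set.Icc b t) := ⟨⊤, ⊥, fun h => hbt (congrArg Subtype.val h).le⟩
  refine exists_orderEmbedding_of_countable (fun F hF => ?_) HomOrder
  obtain ⟨a, ha⟩ := HomOrder.exists_separating (F.image fun p => (p.1.1, p.2.1)) (by
    intro q hq
    obtain ⟨p, hp, rfl⟩ := Finset.mem_image.1 hq
    exact ⟨hF p hp, hb.trans p.2.2.1⟩)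
  refine ⟨⟨b ⊔ t ⊓ a, le_sup_left, sup_le Fact.out inf_le_left⟩, fun p hp => ?_⟩
  obtain ⟨h1, h2⟩ := ha _ (Finset.mem_image_of_mem _ hp)
  refine ⟨fun h => h1 (le_trans ?_ h), fun h => h2 (le_trans h ?_)⟩
  · exact le_inf inf_le_left ((inf_le_inf_right a p.1.2.2).trans le_sup_right)
  · exact sup_le le_sup_left (sup_le (p.2.2.1.trans le_sup_left) (inf_le_right.trans le_sup_right))

namespace FinGraph

lemma complete_two_le_of_adj {G : FinGraph} {x y : G.V} (h : G.graph.Adj x y) :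
    complete 2 ≤ G := by
  refine ⟨⟨![x, y], ?_⟩⟩
  rintro (i j : Fin 2) (hij : i ≠ j)
  fin_cases i <;> fin_cases j
  · exact absurd rfl hij
  · exact h
  · exact h.symm
  · exact absurd rfl hij

lemma complete_one_le (G : FinGraph) : complete 1 ≤ G :=
  have := G.nonempty
  ⟨⟨fun _ => Classical.arbitrary _, fun {i j} h => absurd (Subsingleton.elim (α := Fin 1) i j) h.ne⟩⟩

lemma complete_two_le_or_le_complete_one (G : FinGraph) : complete 2 ≤ G ∨ G ≤ complete 1 := by
  by_cases h : ∃ x y, G.graph.Adj x y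
  · obtain ⟨x, y, h⟩ := h
    exact Or.inl (complete_two_le_of_adj h)
  · exact Or.inr ⟨⟨fun _ => (0 : Fin 1), fun {x y} hxy => absurd ⟨x, y, hxy⟩ h⟩⟩

end FinGraph

theorem theorem3 (G₁ G₂ : FinGraph) (hlt : G₁ < G₂)
    (hgap : ¬ (G₁.HomEquiv (FinGraph.complete 1) ∧ G₂.HomEquiv (FinGraph.complete 2))) :
    Nonempty (HomOrder ↪o Set.Ioo G₁.toHomOrder G₂.toHomOrder) := by
  have hG₂ : FinGraph.complete 2 ≤ G₂ := G₂.complete_two_le_or_le_complete_one.resolve_right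
    fun h => hlt.not_ge (h.trans G₁.complete_one_le)
  -- Replacing `G₁` by `G₁ + K₂` changes nothing unless `G₁` is edgeless, and as the pair is not
  -- the gap `(K₁, K₂)`, the new lower bound is still strictly below `G₂`.
  have hnot : ¬ G₂ ≤ G₁.sum (FinGraph.complete 2) := by
    intro h
    rcases G₁.complete_two_le_or_le_complete_one with h1 | h1
    · exact hlt.not_ge (h.trans (FinGraph.sum_le le_rfl h1))
    · exact hgap ⟨⟨h1, FinGraph.complete_one_le _⟩,
        h.trans (FinGraph.sum_le (h1.trans (FinGraph.complete_one_le _)) le_rfl), hG₂⟩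
  have : Fact ((G₁.sum (FinGraph.complete 2)).toHomOrder ≤ G₂.toHomOrder) :=
    ⟨FinGraph.sum_le hlt.le hG₂⟩
  obtain ⟨f, hf⟩ := HomOrder.exists_orderEmbedding_Icc (b := (G₁.sum (FinGraph.complete 2)).toHomOrder)
    (t := G₂.toHomOrder) hnot (FinGraph.le_sum_right _ _)
  have hG₁ : G₁.toHomOrder ≤ (G₁.sum (FinGraph.complete 2)).toHomOrder := FinGraph.le_sum_left _ _
  exact ⟨OrderEmbedding.ofMapLEIff
    (fun x => ⟨(f x).1, hG₁.trans_lt (hf x).1, (hf x).2⟩) fun x y => f.le_iff_le⟩
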